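/- Let $d\in\{1,2\}$, and let $X_1, X_2, \ldots$ be i.i.d. symmetric $\mathbb{Z}^d$-valued random variables satisfying $\mathbb{P}(X_1=x)=\mathbb{P}(X_1=-x)$ for all $x\in\mathbb{Z}^d$ and $\mathbb{P}(X_1=x)\le C\|x\|^{-2d}$ for some constant $C<\infty$ and all $x\in\mathbb{Z}^d\setminus\{0\}$, where $\|\cdot\|$ is the Euclidean norm. Then the random walk $S_n=\sum_{k=1}^n X_k$ is recurrent, i.e., almost surely $S_n=0$ for infinitely many $n$. -/

import Mathlib

open MeasureTheory ProbabilityTheory Filter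

/-- The Euclidean norm `‖x‖` of a lattice point `x ∈ ℤ^d`. -/
noncomputable def latticeNorm {d : ℕ} (x : Fin d → ℤ) : ℝ :=
  ‖(WithLp.toLp 2 (fun i => (x i : ℝ)) : EuclideanSpace ℝ (Fin d))‖

/-- The walk `S_n = X_1 + ⋯ + X_n` with steps `X_1, X_2, …`; the sequence of steps is indexed from
`0`, so that the step `X_{k+1}` is `X k`. -/
def randomWalk {Ω : Type*} {d : ℕ} (X : ℕ → Ω → (Fin d → ℤ)) (n : ℕ) (ω : Ω) : Fin d → ℤ :=
  ∑ k ∈ Finset.range n, X k ω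

/-- The process `S` on `ℤ^d` is recurrent under `P`: almost surely it is at the origin for
infinitely many times `n`. -/
def IsRecurrent {Ω : Type*} [MeasurableSpace Ω] {d : ℕ} (S : ℕ → Ω → (Fin d → ℤ))
    (P : Measure Ω) : Prop :=
  ∀ᵐ ω ∂P, ∃ᶠ n in atTop, S n ω = 0

/-!
The proof combines the renewal criterion for recurrence with the Chung–Fuchs integral test.

*Renewal.* The events "the walk visits `0` at time `n`, and never afterwards" are disjoint for
distinct `n`, and by independence their probabilities are `q * P (S_n = 0)`, where `q` is the
probability of no return (`measure_last_visit`). If `∑ P (S_n = 0) = ∞`, then `q = 0`, so almost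
surely no visit is the last one (`isRecurrent_of_tsum_eq_top`).

*Fourier.* By symmetry the characteristic function `ψ` of a step is real, and
`(2π) ^ d * P (S_n = 0) = ∫ ψ ^ n` over `(-π, π] ^ d` (`measureReal_randomWalk_eq_zero`). Summing over
even `n` gives the integral of `1 / (1 - ψ ^ 2)` (`tsum_even_visits`), so it suffices that this
integral diverges.

*Tail estimate.* The bound on the point masses gives `P (‖X‖ ≥ 2 ^ j) = O(2 ^ (-j d))`
(`measureReal_tail_le`). Inserted into `1 - cos t ≤ min 2 (t ^ 2 / 2)` scale by scale, and using
`d ≤ 2`, it yields `1 - ψ(θ) = O((k + 1) 2 ^ (-k d))` for `|θ| ≤ 2 ^ (-k)`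
(`one_sub_cosTransform_le`). The cube of frequencies of size `2 ^ (-k)`, of volume
`2 ^ (-(k + 1) d)`, then contributes at least a constant times `1 / (k + 1)` to the integral, and the
harmonic series diverges (`lintegral_inv_one_sub_sq_eq_top`).
-/

/-! ### The renewal criterion for recurrence -/

/-- Shifting the time of an i.i.d. sequence does not change the law of the whole sequence. -/
lemma map_shift_eq_map_of_iid {Ω E : Type*} [MeasurableSpace Ω] [MeasurableSpace E]
    {P : Measure Ω} [IsProbabilityMeasure P] {X : ℕ → Ω → E} (hmeas : ∀ k, Measurable (X k))
    (hindep : iIndepFun X P) (hident : ∀ k, IdentDistrib (X k) (X 0) P P) (n : ℕ) :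
    P.map (fun ω k => X (n + k) ω) = P.map (fun ω k => X k ω) := by
  have hshift : iIndepFun (fun k => X (n + k)) P :=
    hindep.precomp (g := fun k => n + k) (add_right_injective n)
  rw [hshift.map_fun_eq_infinitePi_map (fun k => hmeas (n + k)),
    hindep.map_fun_eq_infinitePi_map hmeas]
  congr 1
  funext k
  rw [(hident (n + k)).map_eq, (hident k).map_eq]

lemma measurable_randomWalk {Ω : Type*} [MeasurableSpace Ω] {d : ℕ} {X : ℕ → Ω → (Fin d → ℤ)}
    (hmeas : ∀ k, Measurable (X k)) (n : ℕ) : Measurable (randomWalk X n) := by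
  unfold randomWalk
  exact Finset.measurable_fun_sum _ fun k _ => hmeas k

lemma randomWalk_add {Ω : Type*} {d : ℕ} (X : ℕ → Ω → (Fin d → ℤ)) (n m : ℕ) (ω : Ω) :
    randomWalk X (n + m) ω = randomWalk X n ω + randomWalk (fun k => X (n + k)) m ω :=
  Finset.sum_range_add _ n m

/-- The trajectories of steps along which the walk never comes back to its starting point. -/
def noReturn (d : ℕ) : Set (ℕ → Fin d → ℤ) :=
  {x | ∀ m, ∑ k ∈ Finset.range (m + 1), x k ≠ 0}

lemma measurableSet_noReturn (d : ℕ) : MeasurableSet (noReturn d) := by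
  unfold noReturn
  rw [Set.ofPred_forall]
  refine MeasurableSet.iInter fun m => ?_
  have h : Measurable (fun x : ℕ → Fin d → ℤ => ∑ k ∈ Finset.range (m + 1), x k) :=
    Finset.measurable_fun_sum _ fun k _ => measurable_pi_apply k
  exact h (MeasurableSet.singleton 0).compl

/-- The Markov property of the walk at its visits to the origin: the probability of a visit at time
`n` with no later visit factorizes, and the second factor does not depend on `n`. -/
lemma measure_last_visit {Ω : Type*} [MeasurableSpace Ω] {d : ℕ} {P : Measure Ω}
    [IsProbabilityMeasure P] {X : ℕ → Ω → (Fin d → ℤ)} (hmeas : ∀ k, Measurable (X k))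
    (hindep : iIndepFun X P) (hident : ∀ k, IdentDistrib (X k) (X 0) P P) (n : ℕ) :
    P ({ω | randomWalk X n ω = 0} ∩ {ω | (fun k => X (n + k) ω) ∈ noReturn d}) =
      P {ω | randomWalk X n ω = 0} * P {ω | (fun k => X k ω) ∈ noReturn d} := by
  set m : ℕ → MeasurableSpace Ω := fun k => MeasurableSpace.comap (X k) inferInstance
  have hI : Indep (⨆ k ∈ Set.Iio n, m k) (⨆ k ∈ Set.Ici n, m k) P :=
    indep_iSup_of_disjoint (fun k => (hmeas k).comap_le) hindep (Set.Iio_disjoint_Ici le_rfl)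
  have h1 : MeasurableSet[⨆ k ∈ Set.Iio n, m k] {ω | randomWalk X n ω = 0} := by
    have : Measurable[⨆ k ∈ Set.Iio n, m k] (randomWalk X n) := by
      unfold randomWalk
      refine Finset.measurable_fun_sum _ fun k hk => ?_
      exact (comap_measurable (X k)).mono
        (le_iSup₂ (f := fun k (_ : k ∈ Set.Iio n) => m k) k (Finset.mem_range.1 hk)) le_rfl
    exact this (MeasurableSet.singleton 0)
  have h2 : MeasurableSet[⨆ k ∈ Set.Ici n, m k] {ω | (fun k => X (n + k) ω) ∈ noReturn d} := by
    have : Measurable[⨆ k ∈ Set.Ici n, m k] (fun ω k => X (n + k) ω) := by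
      refine @measurable_pi_lambda _ _ _ (_) _ _ fun k => ?_
      exact (comap_measurable (X (n + k))).mono
        (le_iSup₂ (f := fun k (_ : k ∈ Set.Ici n) => m k) (n + k) (Nat.le_add_right n k)) le_rfl
    exact this (measurableSet_noReturn d)
  rw [(Indep_iff _ _ P).1 hI _ _ h1 h2]
  congr 1
  have hN := measurableSet_noReturn d
  have := congrArg (fun μ => μ (noReturn d)) (map_shift_eq_map_of_iid hmeas hindep hident n)
  rwa [Measure.map_apply (by fun_prop) hN, Measure.map_apply (by fun_prop) hN] at this

/-- The renewal criterion: the walk is recurrent as soon as its expected number of visits to the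
origin is infinite. -/
lemma isRecurrent_of_tsum_eq_top {Ω : Type*} [MeasurableSpace Ω] {d : ℕ} {P : Measure Ω}
    [IsProbabilityMeasure P] {X : ℕ → Ω → (Fin d → ℤ)} (hmeas : ∀ k, Measurable (X k))
    (hindep : iIndepFun X P) (hident : ∀ k, IdentDistrib (X k) (X 0) P P)
    (hsum : ∑' n, P {ω | randomWalk X n ω = 0} = ⊤) : IsRecurrent (randomWalk X) P := by
  set B : ℕ → Set Ω := fun n =>
    {ω | randomWalk X n ω = 0} ∩ {ω | (fun k => X (n + k) ω) ∈ noReturn d} with hB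
  have hmemB : ∀ n ω, ω ∈ B n ↔ randomWalk X n ω = 0 ∧ ∀ m, n < m → randomWalk X m ω ≠ 0 := by
    intro n ω
    simp only [hB, noReturn, Set.mem_inter_iff, Set.mem_ofPred_eq]
    refine and_congr_right fun h0 => ⟨fun h m hm => ?_, fun h m => ?_⟩
    · obtain ⟨k, rfl⟩ := Nat.exists_eq_add_of_lt hm
      rw [add_assoc, randomWalk_add, h0, zero_add]
      exact h k
    · have := h (n + (m + 1)) (by omega)
      rwa [randomWalk_add, h0, zero_add] at this
  have hBmeas : ∀ n, MeasurableSet (B n) := fun n =>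
    ((measurable_randomWalk hmeas n) (MeasurableSet.singleton 0)).inter
      ((show Measurable (fun ω k => X (n + k) ω) by fun_prop) (measurableSet_noReturn d))
  have hdisj : Pairwise (Function.onFun Disjoint B) := by
    intro a b hab
    refine Set.disjoint_left.2 fun ω ha hb => ?_
    rw [hmemB] at ha hb
    rcases lt_or_gt_of_ne hab with h | h
    · exact ha.2 b h hb.1
    · exact hb.2 a h ha.1
  -- The last visits at distinct times are disjoint events, so their probabilities sum to at most 1.
  have hle : ∑' n, P (B n) ≤ 1 := by
    rw [← measure_iUnion hdisj hBmeas]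
    exact prob_le_one
  have hq : P {ω | (fun k => X k ω) ∈ noReturn d} = 0 := by
    by_contra hne
    simp only [hB, measure_last_visit hmeas hindep hident, ENNReal.tsum_mul_right, hsum,
      ENNReal.top_mul hne] at hle
    exact absurd hle (by simp)
  have hnull : P (⋃ n, B n) = 0 := by
    rw [measure_iUnion_null_iff]
    intro n
    simp only [hB, measure_last_visit hmeas hindep hident, hq, mul_zero]
  -- The walk starts at the origin, so if its visits stop, there is a last one.
  refine measure_mono_null (fun ω hω => ?_) hnull
  simp only [Set.mem_compl_iff, Set.mem_ofPred_eq, not_frequently, eventually_atTop] at hω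
  obtain ⟨N, hN⟩ := hω
  have hfin : {n | randomWalk X n ω = 0}.Finite :=
    (Set.finite_lt_nat N).subset fun n hn => by
      by_contra h
      exact hN n (not_lt.1 h) hn
  obtain ⟨n, hn, hmax⟩ := hfin.exists_maximalFor id _ ⟨0, by simp [randomWalk]⟩
  refine Set.mem_iUnion.2 ⟨n, (hmemB n ω).2 ⟨hn, fun m hm h0 => ?_⟩⟩
  exact absurd (hmax h0 hm.le) (not_le.2 hm)

/-! ### Fourier analysis of the return probabilities -/

/-- The pairing `θ · x` of a frequency `θ ∈ ℝ^d` with a lattice point `x ∈ ℤ^d`. -/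
noncomputable def phase {d : ℕ} (θ : Fin d → ℝ) (x : Fin d → ℤ) : ℝ := ∑ i, θ i * x i

/-- The real part `θ ↦ E[cos (θ · Y)]` of the characteristic function of `Y`; for symmetric `Y` it
is the characteristic function itself. -/
noncomputable def cosTransform {Ω : Type*} [MeasurableSpace Ω] {d : ℕ} (P : Measure Ω)
    (Y : Ω → Fin d → ℤ) (θ : Fin d → ℝ) : ℝ := ∫ ω, Real.cos (phase θ (Y ω)) ∂P

/-- Lebesgue measure on the fundamental domain `(-π, π]^d` of the dual torus. -/
noncomputable def torusMeasure (d : ℕ) : Measure (Fin d → ℝ) :=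
  Measure.pi fun _ => volume.restrict (Set.Ioc (-Real.pi) Real.pi)

instance (d : ℕ) : IsFiniteMeasure (torusMeasure d) := by
  unfold torusMeasure; infer_instance

lemma phase_neg {d : ℕ} (θ : Fin d → ℝ) (x : Fin d → ℤ) : phase θ (-x) = -phase θ x := by
  simp [phase]

lemma phase_sum {d : ℕ} {ι : Type*} (θ : Fin d → ℝ) (s : Finset ι) (x : ι → Fin d → ℤ) :
    phase θ (∑ k ∈ s, x k) = ∑ k ∈ s, phase θ (x k) := by
  simp only [phase, Finset.sum_apply, Int.cast_sum, Finset.mul_sum]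
  exact Finset.sum_comm

lemma measurable_uncurry_phase (d : ℕ) :
    Measurable fun p : (Fin d → ℝ) × (Fin d → ℤ) => phase p.1 p.2 := by
  unfold phase
  refine Finset.measurable_fun_sum _ fun i _ => ?_
  have h : Measurable fun p : (Fin d → ℝ) × (Fin d → ℤ) => ((p.2 i : ℤ) : ℝ) :=
    (measurable_from_top (f := fun z : ℤ => (z : ℝ))).comp
      ((measurable_pi_apply i).comp measurable_snd)
  exact ((measurable_pi_apply i).comp measurable_fst).mul h

lemma measurable_phase {d : ℕ} (θ : Fin d → ℝ) : Measurable (phase θ) :=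
  (measurable_uncurry_phase d).comp measurable_prodMk_left

lemma abs_cosTransform_le_one {Ω : Type*} [MeasurableSpace Ω] {d : ℕ} (P : Measure Ω)
    [IsProbabilityMeasure P] (Y : Ω → Fin d → ℤ) (θ : Fin d → ℝ) : |cosTransform P Y θ| ≤ 1 := by
  have := norm_integral_le_of_norm_le_const (μ := P) (f := fun ω => Real.cos (phase θ (Y ω)))
    (C := 1) (Eventually.of_forall fun ω => by simpa using Real.abs_cos_le_one _)
  simpa [cosTransform] using this

lemma measurable_cosTransform {Ω : Type*} [MeasurableSpace Ω] {d : ℕ} (P : Measure Ω)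
    [IsProbabilityMeasure P] {Y : Ω → Fin d → ℤ} (hY : Measurable Y) :
    Measurable (cosTransform P Y) := by
  have h : Measurable fun p : (Fin d → ℝ) × Ω => Real.cos (phase p.1 (Y p.2)) :=
    Real.measurable_cos.comp ((measurable_uncurry_phase d).comp
      (measurable_fst.prodMk (hY.comp measurable_snd)))
  exact h.stronglyMeasurable.integral_prod_right.measurable

lemma integral_exp_phase_eq_cosTransform {Ω : Type*} [MeasurableSpace Ω] {d : ℕ} {P : Measure Ω}
    [IsProbabilityMeasure P] {Y : Ω → Fin d → ℤ} (hY : Measurable Y)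
    (hsymm : ∀ x : Fin d → ℤ, P.real {ω | Y ω = x} = P.real {ω | Y ω = -x}) (θ : Fin d → ℝ) :
    ∫ ω, Complex.exp (phase θ (Y ω) * Complex.I) ∂P = cosTransform P Y θ := by
  have hlaw : P.map Y = P.map (-Y) := by
    refine Measure.ext_of_singleton fun x => ?_
    rw [Measure.map_apply hY (MeasurableSet.singleton x),
      Measure.map_apply hY.neg (MeasurableSet.singleton x)]
    have h := hsymm x
    rw [measureReal_eq_measureReal_iff] at h
    have hset : (-Y) ⁻¹' {x} = {ω | Y ω = -x} := by
      ext ω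
      exact neg_eq_iff_eq_neg
    rw [hset]
    exact h
  have hph : Measurable fun ω => phase θ (Y ω) := (measurable_phase θ).comp hY
  have hsin : ∫ ω, Real.sin (phase θ (Y ω)) ∂P = 0 := by
    have hf : Measurable fun x : Fin d → ℤ => Real.sin (phase θ x) :=
      Real.measurable_sin.comp (measurable_phase θ)
    have h1 := integral_map (μ := P) hY.aemeasurable
      (f := fun x => Real.sin (phase θ x)) hf.aestronglyMeasurable
    have h2 := integral_map (μ := P) hY.neg.aemeasurable
      (f := fun x => Real.sin (phase θ x)) hf.aestronglyMeasurable
    rw [← hlaw, h1] at h2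
    simp only [phase_neg, Real.sin_neg, integral_neg, Pi.neg_apply] at h2
    linarith
  have hcosi : Integrable (fun ω => Real.cos (phase θ (Y ω))) P :=
    Integrable.of_bound (Real.measurable_cos.comp hph).aestronglyMeasurable 1
      (Eventually.of_forall fun ω => by simpa using Real.abs_cos_le_one _)
  have hsini : Integrable (fun ω => Real.sin (phase θ (Y ω))) P :=
    Integrable.of_bound (Real.measurable_sin.comp hph).aestronglyMeasurable 1
      (Eventually.of_forall fun ω => by simpa using Real.abs_sin_le_one _)
  simp only [Complex.exp_mul_I, ← Complex.ofReal_cos, ← Complex.ofReal_sin]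
  rw [integral_add hcosi.ofReal (hsini.ofReal.mul_const _), integral_mul_const,
    integral_complex_ofReal, integral_complex_ofReal, hsin]
  simp [cosTransform]

/-- Independence turns the characteristic function of `S_n` into a power. -/
lemma integral_exp_phase_randomWalk {Ω : Type*} [MeasurableSpace Ω] {d : ℕ} {P : Measure Ω}
    [IsProbabilityMeasure P] {X : ℕ → Ω → (Fin d → ℤ)} (hmeas : ∀ k, Measurable (X k))
    (hindep : iIndepFun X P) (hident : ∀ k, IdentDistrib (X k) (X 0) P P)
    (hsymm : ∀ x : Fin d → ℤ, P.real {ω | X 0 ω = x} = P.real {ω | X 0 ω = -x})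
    (θ : Fin d → ℝ) (n : ℕ) :
    ∫ ω, Complex.exp (phase θ (randomWalk X n ω) * Complex.I) ∂P = (cosTransform P (X 0) θ) ^ n := by
  have hg : Measurable fun x : Fin d → ℤ => Complex.exp (phase θ x * Complex.I) :=
    Complex.measurable_exp.comp
      ((Complex.measurable_ofReal.comp (measurable_phase θ)).mul_const _)
  have hind : iIndepFun (fun (k : Fin n) ω => Complex.exp (phase θ (X k ω) * Complex.I)) P :=
    (hindep.precomp (g := fun k : Fin n => (k : ℕ)) Fin.val_injective).comp
      (fun _ x => Complex.exp (phase θ x * Complex.I)) (fun _ => hg)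
  have hprod : ∀ ω, Complex.exp (phase θ (randomWalk X n ω) * Complex.I) =
      ∏ k : Fin n, Complex.exp (phase θ (X k ω) * Complex.I) := by
    intro ω
    rw [randomWalk, phase_sum, Finset.sum_range, Complex.ofReal_sum, Finset.sum_mul,
      Complex.exp_sum]
  simp only [hprod]
  rw [hind.integral_fun_prod_eq_prod_integral
    fun k => (hg.comp (hmeas k)).aestronglyMeasurable]
  have : ∀ k : Fin n, ∫ ω, Complex.exp (phase θ (X k ω) * Complex.I) ∂P =
      cosTransform P (X 0) θ := by
    intro k
    rw [← integral_exp_phase_eq_cosTransform (hmeas 0) hsymm θ]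
    exact ((hident k).comp hg).integral_eq
  simp [this]

/-- Orthogonality of the characters of the torus to the constant function. -/
lemma integral_exp_phase_torus {d : ℕ} (x : Fin d → ℤ) :
    ∫ θ, Complex.exp (phase θ x * Complex.I) ∂torusMeasure d =
      if x = 0 then ((2 * Real.pi) ^ d : ℂ) else 0 := by
  have hprod : ∀ θ : Fin d → ℝ, Complex.exp (phase θ x * Complex.I) =
      ∏ i, Complex.exp ((x i : ℂ) * Complex.I * (θ i : ℝ)) := by
    intro θ
    rw [phase, ← Complex.exp_sum, Complex.ofReal_sum, Finset.sum_mul]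
    congr 1
    refine Finset.sum_congr rfl fun i _ => ?_
    push_cast
    ring
  simp only [hprod]
  rw [torusMeasure, integral_fintype_prod_eq_prod
    (f := fun i (t : ℝ) => Complex.exp ((x i : ℂ) * Complex.I * (t : ℝ)))]
  simp only [← intervalIntegral.integral_of_le (neg_le_self Real.pi_pos.le)]
  split_ifs with hx
  · subst hx
    simp [← two_mul]
  · obtain ⟨i, hi⟩ := Function.ne_iff.1 hx
    refine Finset.prod_eq_zero (Finset.mem_univ i) ?_
    have hc : (x i : ℂ) * Complex.I ≠ 0 :=
      mul_ne_zero (Int.cast_ne_zero.2 hi) Complex.I_ne_zero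
    rw [integral_exp_mul_complex hc, div_eq_zero_iff, sub_eq_zero]
    left
    rw [Complex.exp_eq_exp_iff_exists_int]
    refine ⟨x i, ?_⟩
    push_cast
    ring

/-- Fourier inversion at the origin. -/
lemma measureReal_randomWalk_eq_zero {Ω : Type*} [MeasurableSpace Ω] {d : ℕ} {P : Measure Ω}
    [IsProbabilityMeasure P] {X : ℕ → Ω → (Fin d → ℤ)} (hmeas : ∀ k, Measurable (X k))
    (hindep : iIndepFun X P) (hident : ∀ k, IdentDistrib (X k) (X 0) P P)
    (hsymm : ∀ x : Fin d → ℤ, P.real {ω | X 0 ω = x} = P.real {ω | X 0 ω = -x}) (n : ℕ) :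
    ∫ θ, cosTransform P (X 0) θ ^ n ∂torusMeasure d =
      (2 * Real.pi) ^ d * P.real {ω | randomWalk X n ω = 0} := by
  have hS : Measurable (randomWalk X n) := measurable_randomWalk hmeas n
  have hm : Measurable fun p : (Fin d → ℝ) × Ω =>
      Complex.exp (phase p.1 (randomWalk X n p.2) * Complex.I) :=
    Complex.measurable_exp.comp ((Complex.measurable_ofReal.comp
      ((measurable_uncurry_phase d).comp
        (measurable_fst.prodMk (hS.comp measurable_snd)))).mul_const _)
  have hswap := integral_integral_swap (μ := torusMeasure d) (ν := P)
    (f := fun θ ω => Complex.exp (phase θ (randomWalk X n ω) * Complex.I))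
    (Integrable.of_bound hm.aestronglyMeasurable 1
      (Eventually.of_forall fun p => (Complex.norm_exp_ofReal_mul_I _).le))
  simp only [integral_exp_phase_randomWalk hmeas hindep hident hsymm,
    integral_exp_phase_torus] at hswap
  have hind : ∀ ω, (if randomWalk X n ω = 0 then ((2 * Real.pi) ^ d : ℂ) else 0) =
      Set.indicator {ω | randomWalk X n ω = 0} (fun _ => ((2 * Real.pi) ^ d : ℂ)) ω := by
    intro ω
    simp [Set.indicator_apply]
  simp only [hind] at hswap
  rw [integral_indicator_const _ (show MeasurableSet {ω | randomWalk X n ω = 0} from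
    hS (MeasurableSet.singleton 0))] at hswap
  simp only [← Complex.ofReal_pow, integral_complex_ofReal] at hswap
  have h2 : ((∫ θ, cosTransform P (X 0) θ ^ n ∂torusMeasure d : ℝ) : ℂ) =
      (((2 * Real.pi) ^ d * P.real {ω | randomWalk X n ω = 0} : ℝ) : ℂ) := by
    rw [hswap]
    simp [mul_comm]
  exact_mod_cast h2

/-- The expected number of visits to the origin at even times, as an integral over the torus.
Even times keep the integrands nonnegative, so that sum and integral may be exchanged. -/
lemma tsum_even_visits {Ω : Type*} [MeasurableSpace Ω] {d : ℕ} {P : Measure Ω}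
    [IsProbabilityMeasure P] {X : ℕ → Ω → (Fin d → ℤ)} (hmeas : ∀ k, Measurable (X k))
    (hindep : iIndepFun X P) (hident : ∀ k, IdentDistrib (X k) (X 0) P P)
    (hsymm : ∀ x : Fin d → ℤ, P.real {ω | X 0 ω = x} = P.real {ω | X 0 ω = -x}) :
    ∫⁻ θ, (1 - ENNReal.ofReal (cosTransform P (X 0) θ ^ 2))⁻¹ ∂torusMeasure d =
      ENNReal.ofReal ((2 * Real.pi) ^ d) * ∑' n, P {ω | randomWalk X (2 * n) ω = 0} := by
  have hψ := measurable_cosTransform P (hmeas 0)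
  simp only [← ENNReal.tsum_geometric, ← ENNReal.ofReal_pow (sq_nonneg _), ← pow_mul]
  rw [lintegral_tsum fun n => (hψ.pow_const _).ennreal_ofReal.aemeasurable,
    ← ENNReal.tsum_mul_left]
  congr 1
  funext n
  rw [← ofReal_integral_eq_lintegral_ofReal,
    measureReal_randomWalk_eq_zero hmeas hindep hident hsymm, ENNReal.ofReal_mul (by positivity),
    ofReal_measureReal]
  · refine Integrable.of_bound (hψ.pow_const _).aestronglyMeasurable 1
      (Eventually.of_forall fun θ => ?_)
    rw [Real.norm_eq_abs, abs_pow]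
    exact pow_le_one₀ (abs_nonneg _) (abs_cosTransform_le_one P (X 0) θ)
  · exact Eventually.of_forall fun θ => (even_two_mul n).pow_nonneg _

/-! ### The characteristic function near the origin -/

lemma norm_le_latticeNorm {d : ℕ} (x : Fin d → ℤ) : ‖x‖ ≤ latticeNorm x := by
  refine (pi_norm_le_iff_of_nonneg (norm_nonneg _)).2 fun i => ?_
  have := PiLp.norm_apply_le (WithLp.toLp 2 (fun i => (x i : ℝ)) : EuclideanSpace ℝ (Fin d)) i
  simpa [latticeNorm, Int.norm_eq_abs] using this

/-- A dyadic shell has `O(2 ^ (j d))` points, each of probability `O(2 ^ (-2 j d))`. -/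
lemma measureReal_shell_le {Ω : Type*} [MeasurableSpace Ω] {P : Measure Ω}
    [IsProbabilityMeasure P] {d : ℕ} {Y : Ω → Fin d → ℤ} {C : ℝ}
    (htail : ∀ x : Fin d → ℤ, x ≠ 0 → P.real {ω | Y ω = x} ≤ C / latticeNorm x ^ (2 * d)) (j : ℕ) :
    P.real {ω | (2 : ℝ) ^ j ≤ ‖Y ω‖ ∧ ‖Y ω‖ < 2 ^ (j + 1)} ≤ 8 ^ d * |C| / (2 ^ j) ^ d := by
  set B : Finset (Fin d → ℤ) := Finset.Icc (fun _ => -2 ^ (j + 1)) (fun _ => 2 ^ (j + 1)) with hB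
  set F := B.filter (fun x => (2 : ℝ) ^ j ≤ ‖x‖)
  have hsub : {ω | (2 : ℝ) ^ j ≤ ‖Y ω‖ ∧ ‖Y ω‖ < 2 ^ (j + 1)} ⊆ ⋃ x ∈ F, {ω | Y ω = x} := by
    rintro ω ⟨h1, h2⟩
    refine Set.mem_iUnion₂.2 ⟨Y ω, Finset.mem_filter.2 ⟨?_, h1⟩, rfl⟩
    have hi : ∀ i, |Y ω i| ≤ 2 ^ (j + 1) := by
      intro i
      have := (norm_le_pi_norm (Y ω) i).trans h2.le
      rw [Int.norm_eq_abs] at this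
      exact_mod_cast this
    exact Finset.mem_Icc.2 ⟨fun i => (abs_le.1 (hi i)).1, fun i => (abs_le.1 (hi i)).2⟩
  have hcard : (B.card : ℝ) ≤ (8 * 2 ^ j) ^ d := by
    have h1 : B.card = (2 * 2 ^ (j + 1) + 1) ^ d := by
      rw [hB, Pi.card_Icc]
      simp only [Int.card_Icc, Finset.prod_const, Finset.card_univ, Fintype.card_fin]
      congr 1
      have : (2 ^ (j + 1) + 1 - -2 ^ (j + 1) : ℤ) = ((2 * 2 ^ (j + 1) + 1 : ℕ) : ℤ) := by
        push_cast
        ring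
      rw [this, Int.toNat_natCast]
    rw [h1]
    push_cast
    refine pow_le_pow_left₀ (by positivity) ?_ d
    have : (1 : ℝ) ≤ 2 ^ j := one_le_pow₀ (by norm_num)
    rw [pow_succ]
    linarith
  have hterm : ∀ x ∈ F, P.real {ω | Y ω = x} ≤ |C| / (2 ^ j) ^ (2 * d) := by
    intro x hx
    have hx2 : (2 : ℝ) ^ j ≤ ‖x‖ := (Finset.mem_filter.1 hx).2
    have hpos : (0 : ℝ) < 2 ^ j := by positivity
    have hx0 : x ≠ 0 := norm_pos_iff.1 (hpos.trans_le hx2)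
    refine (htail x hx0).trans ?_
    have := hx2.trans (norm_le_latticeNorm x)
    exact div_le_div₀ (abs_nonneg C) (le_abs_self C) (by positivity)
      (pow_le_pow_left₀ hpos.le this _)
  calc _ ≤ P.real (⋃ x ∈ F, {ω | Y ω = x}) :=
      measureReal_mono hsub (measure_ne_top _ _)
    _ ≤ ∑ x ∈ F, P.real {ω | Y ω = x} := measureReal_biUnion_finset_le _ _
    _ ≤ F.card • (|C| / (2 ^ j) ^ (2 * d)) := Finset.sum_le_card_nsmul _ _ _ hterm
    _ ≤ (8 * 2 ^ j) ^ d * (|C| / (2 ^ j) ^ (2 * d)) := by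
      rw [nsmul_eq_mul]
      refine mul_le_mul_of_nonneg_right (le_trans ?_ hcard) (by positivity)
      exact_mod_cast Finset.card_filter_le _ _
    _ = 8 ^ d * |C| / (2 ^ j) ^ d := by
      rw [mul_pow, two_mul, pow_add]
      field_simp

lemma measureReal_tail_le {Ω : Type*} [MeasurableSpace Ω] {P : Measure Ω}
    [IsProbabilityMeasure P] {d : ℕ} (hd : d ≠ 0) {Y : Ω → Fin d → ℤ} {C : ℝ}
    (htail : ∀ x : Fin d → ℤ, x ≠ 0 → P.real {ω | Y ω = x} ≤ C / latticeNorm x ^ (2 * d)) (k : ℕ) :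
    P.real {ω | (2 : ℝ) ^ k ≤ ‖Y ω‖} ≤ 2 * (8 ^ d * |C|) / (2 ^ k) ^ d := by
  set M : ℝ := 8 ^ d * |C|
  have hM : 0 ≤ M := by positivity
  have hsub : {ω | (2 : ℝ) ^ k ≤ ‖Y ω‖} ⊆
      ⋃ i : ℕ, {ω | (2 : ℝ) ^ (k + i) ≤ ‖Y ω‖ ∧ ‖Y ω‖ < 2 ^ (k + i + 1)} := by
    intro ω (hω : (2 : ℝ) ^ k ≤ ‖Y ω‖)
    obtain ⟨n, hn1, hn2⟩ := exists_nat_pow_near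
      ((one_le_pow₀ (by norm_num : (1 : ℝ) ≤ 2)).trans hω) (by norm_num : (1 : ℝ) < 2)
    have hkn : k < n + 1 := (pow_lt_pow_iff_right₀ (by norm_num : (1 : ℝ) < 2)).1 (hω.trans_lt hn2)
    obtain ⟨i, rfl⟩ := Nat.exists_eq_add_of_le (Nat.lt_succ_iff.1 hkn)
    exact Set.mem_iUnion.2 ⟨i, hn1, hn2⟩
  have hterm : ∀ i : ℕ, P {ω | (2 : ℝ) ^ (k + i) ≤ ‖Y ω‖ ∧ ‖Y ω‖ < 2 ^ (k + i + 1)} ≤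
      ENNReal.ofReal (M / (2 ^ k) ^ d * (1 / 2) ^ i) := by
    intro i
    rw [← ofReal_measureReal]
    refine ENNReal.ofReal_le_ofReal ((measureReal_shell_le htail (k + i)).trans ?_)
    have h2 : (2 : ℝ) ^ i ≤ (2 ^ i) ^ d := le_self_pow₀ (one_le_pow₀ (by norm_num)) hd
    rw [pow_add, mul_pow, one_div, inv_pow, ← div_eq_mul_inv, div_div]
    exact div_le_div_of_nonneg_left hM (by positivity)
      (mul_le_mul_of_nonneg_left h2 (by positivity))
  have hsum : HasSum (fun i : ℕ => M / (2 ^ k) ^ d * (1 / 2) ^ i) (M / (2 ^ k) ^ d * 2) :=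
    hasSum_geometric_two.mul_left _
  have : P {ω | (2 : ℝ) ^ k ≤ ‖Y ω‖} ≤ ENNReal.ofReal (2 * M / (2 ^ k) ^ d) :=
    calc _ ≤ _ := measure_mono hsub
      _ ≤ _ := measure_iUnion_le _
      _ ≤ _ := ENNReal.tsum_le_tsum hterm
      _ = ENNReal.ofReal (M / (2 ^ k) ^ d * 2) := by
        rw [← ENNReal.ofReal_tsum_of_nonneg (fun i => by positivity) hsum.summable, hsum.tsum_eq]
      _ = _ := by ring_nf
  exact ENNReal.toReal_le_of_le_ofReal (by positivity) this

lemma abs_phase_le {d : ℕ} {θ : Fin d → ℝ} {r : ℝ} (hθ : ∀ i, |θ i| ≤ r) (x : Fin d → ℤ) :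
    |phase θ x| ≤ d * (r * ‖x‖) := by
  calc |phase θ x| ≤ ∑ i, |θ i * x i| := Finset.abs_sum_le_sum_abs _ _
    _ ≤ ∑ _i : Fin d, r * ‖x‖ := by
      refine Finset.sum_le_sum fun i _ => ?_
      rw [abs_mul]
      refine mul_le_mul (hθ i) ?_ (abs_nonneg _) ((abs_nonneg _).trans (hθ i))
      rw [← Int.norm_eq_abs]
      exact norm_le_pi_norm x i
    _ = d * (r * ‖x‖) := by simp

/-- The bound `1 - cos t ≤ min 2 (t ^ 2 / 2)`, cut into dyadic scales of `x`. -/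
lemma one_sub_cos_phase_le {d : ℕ} (hd : d ≠ 0) {θ : Fin d → ℝ} {k : ℕ}
    (hθ : ∀ i, |θ i| ≤ 1 / 2 ^ k) (x : Fin d → ℤ) :
    1 - Real.cos (phase θ x) ≤ ∑ j ∈ Finset.range (k + 1),
      {y : Fin d → ℤ | (2 : ℝ) ^ j ≤ ‖y‖}.indicator
        (fun _ => 2 * (d : ℝ) ^ 2 * (4 ^ j / 4 ^ k)) x := by
  have hnn : ∀ j ∈ Finset.range (k + 1), 0 ≤ {y : Fin d → ℤ | (2 : ℝ) ^ j ≤ ‖y‖}.indicator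
      (fun _ => 2 * (d : ℝ) ^ 2 * (4 ^ j / 4 ^ k)) x :=
    fun j _ => Set.indicator_nonneg (fun _ _ => by positivity) x
  by_cases hx : x = 0
  · subst hx
    simp [phase]
  have hx1 : 1 ≤ ‖x‖ := by
    obtain ⟨i, hi⟩ := Function.ne_iff.1 hx
    refine le_trans ?_ (norm_le_pi_norm x i)
    rw [Int.norm_eq_abs]
    exact_mod_cast Int.one_le_abs hi
  have hd1 : (1 : ℝ) ≤ d := by exact_mod_cast Nat.one_le_iff_ne_zero.2 hd
  obtain ⟨n, hn1, hn2⟩ := exists_nat_pow_near hx1 (by norm_num : (1 : ℝ) < 2)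
  -- The term of scale `min n k` alone dominates.
  rcases le_total n k with hnk | hkn
  · refine le_trans ?_ (Finset.single_le_sum hnn (Finset.mem_range.2 (Nat.lt_succ_of_le hnk)))
    rw [Set.indicator_of_mem (show x ∈ {y : Fin d → ℤ | (2 : ℝ) ^ n ≤ ‖y‖} from hn1)]
    have h1 := Real.one_sub_sq_div_two_le_cos (x := phase θ x)
    have h2 : |phase θ x| ≤ d * (1 / 2 ^ k * 2 ^ (n + 1)) :=
      (abs_phase_le hθ x).trans (by gcongr)
    have h3 : phase θ x ^ 2 ≤ (d * (1 / 2 ^ k * 2 ^ (n + 1))) ^ 2 := sq_le_sq' (by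
      linarith [neg_abs_le (phase θ x)]) ((le_abs_self _).trans h2)
    have h4 : ((d : ℝ) * (1 / 2 ^ k * 2 ^ (n + 1))) ^ 2 = 4 * (d : ℝ) ^ 2 * (4 ^ n / 4 ^ k) := by
      rw [show (4 : ℝ) = 2 ^ 2 by norm_num, ← pow_mul, ← pow_mul, pow_succ]
      field_simp
      ring
    linarith
  · refine le_trans ?_ (Finset.single_le_sum hnn (Finset.mem_range.2 (Nat.lt_succ_self k)))
    rw [Set.indicator_of_mem (show x ∈ {y : Fin d → ℤ | (2 : ℝ) ^ k ≤ ‖y‖} from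
      (pow_le_pow_right₀ (by norm_num) hkn).trans hn1), div_self (by positivity)]
    nlinarith [Real.neg_one_le_cos (phase θ x)]

/-- The behaviour of the characteristic function near the origin, at dyadic scales:
`1 - ψ(θ) = O(|θ| ^ d log (1 / |θ|))`. The logarithm is the true order for `d = 2`; for `d = 1` it
can be dispensed with, but it does no harm and keeps the two cases together. -/
lemma one_sub_cosTransform_le {Ω : Type*} [MeasurableSpace Ω] {P : Measure Ω}
    [IsProbabilityMeasure P] {d : ℕ} (hd : d = 1 ∨ d = 2) {Y : Ω → Fin d → ℤ} (hY : Measurable Y)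
    {C : ℝ}
    (htail : ∀ x : Fin d → ℤ, x ≠ 0 → P.real {ω | Y ω = x} ≤ C / latticeNorm x ^ (2 * d))
    {θ : Fin d → ℝ} {k : ℕ} (hθ : ∀ i, |θ i| ≤ 1 / 2 ^ k) :
    1 - cosTransform P Y θ ≤
      2 * (d : ℝ) ^ 2 * (2 * (8 ^ d * |C|)) * ((k + 1) / (2 ^ k) ^ d) := by
  have hd0 : d ≠ 0 := by omega
  set M : ℝ := 2 * (8 ^ d * |C|)
  have hM : 0 ≤ M := by positivity
  have hcos : Integrable (fun ω => Real.cos (phase θ (Y ω))) P :=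
    Integrable.of_bound (Real.measurable_cos.comp
      ((measurable_phase θ).comp hY)).aestronglyMeasurable 1
      (Eventually.of_forall fun ω => by simpa using Real.abs_cos_le_one _)
  have hmeas : ∀ j : ℕ, MeasurableSet {ω | (2 : ℝ) ^ j ≤ ‖Y ω‖} := fun j =>
    hY (Set.to_countable {y : Fin d → ℤ | (2 : ℝ) ^ j ≤ ‖y‖}).measurableSet
  have hint : ∀ j : ℕ, Integrable ({ω | (2 : ℝ) ^ j ≤ ‖Y ω‖}.indicator
      (fun _ => 2 * (d : ℝ) ^ 2 * (4 ^ j / 4 ^ k))) P := fun j =>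
    (integrable_const _).indicator (hmeas j)
  have hscale : ∀ j ∈ Finset.range (k + 1),
      (4 : ℝ) ^ j / 4 ^ k / (2 ^ j) ^ d ≤ 1 / (2 ^ k) ^ d := by
    intro j hj
    have hjk : (2 : ℝ) ^ j ≤ 2 ^ k :=
      pow_le_pow_right₀ (by norm_num) (Nat.lt_succ_iff.1 (Finset.mem_range.1 hj))
    have h4 : ∀ n : ℕ, (4 : ℝ) ^ n = (2 ^ n) ^ 2 := fun n => by
      rw [← pow_mul, mul_comm, pow_mul]
      norm_num
    rw [h4, h4, div_div, div_le_div_iff₀ (by positivity) (by positivity)]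
    have h0 : (0 : ℝ) < 2 ^ j := by positivity
    rcases hd with rfl | rfl
    · have : (2 : ℝ) ^ j * (2 ^ j * 2 ^ k) ≤ 2 ^ k * (2 ^ j * 2 ^ k) := by gcongr
      linarith
    · linarith
  calc 1 - cosTransform P Y θ = ∫ ω, (1 - Real.cos (phase θ (Y ω))) ∂P := by
        rw [integral_sub (integrable_const _) hcos]
        simp [cosTransform]
    _ ≤ ∫ ω, ∑ j ∈ Finset.range (k + 1), {ω | (2 : ℝ) ^ j ≤ ‖Y ω‖}.indicator
          (fun _ => 2 * (d : ℝ) ^ 2 * (4 ^ j / 4 ^ k)) ω ∂P :=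
        integral_mono ((integrable_const _).sub hcos) (integrable_finsetSum _ fun j _ => hint j)
          fun ω => one_sub_cos_phase_le hd0 hθ (Y ω)
    _ = ∑ j ∈ Finset.range (k + 1),
          P.real {ω | (2 : ℝ) ^ j ≤ ‖Y ω‖} * (2 * (d : ℝ) ^ 2 * (4 ^ j / 4 ^ k)) := by
        rw [integral_finsetSum _ fun j _ => hint j]
        simp only [integral_indicator_const _ (hmeas _), smul_eq_mul]
    _ ≤ ∑ j ∈ Finset.range (k + 1), 2 * (d : ℝ) ^ 2 * M * (1 / (2 ^ k) ^ d) := by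
        refine Finset.sum_le_sum fun j hj => ?_
        calc _ ≤ M / (2 ^ j) ^ d * (2 * (d : ℝ) ^ 2 * (4 ^ j / 4 ^ k)) :=
              mul_le_mul_of_nonneg_right (measureReal_tail_le hd0 htail j) (by positivity)
          _ = 2 * (d : ℝ) ^ 2 * M * ((4 : ℝ) ^ j / 4 ^ k / (2 ^ j) ^ d) := by ring
          _ ≤ _ := mul_le_mul_of_nonneg_left (hscale j hj) (by positivity)
    _ = _ := by
        rw [Finset.sum_const, Finset.card_range, nsmul_eq_mul]
        push_cast
        ring

/-! ### Divergence of the Chung–Fuchs integral -/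

/-- The cube of frequencies with all coordinates in `(2 ^ (-k - 1), 2 ^ (-k)]`. -/
def dyadicCube (d k : ℕ) : Set (Fin d → ℝ) :=
  Set.univ.pi fun _ => Set.Ioc (1 / 2 ^ (k + 1)) (1 / 2 ^ k)

lemma measurableSet_dyadicCube (d k : ℕ) : MeasurableSet (dyadicCube d k) :=
  MeasurableSet.univ_pi fun _ => measurableSet_Ioc

lemma pairwise_disjoint_dyadicCube {d : ℕ} (hd : d ≠ 0) :
    Pairwise (Function.onFun Disjoint (dyadicCube d)) := by
  have key : ∀ a b : ℕ, a < b → Disjoint (dyadicCube d a) (dyadicCube d b) := by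
    intro a b hab
    refine Set.disjoint_left.2 fun θ ha hb => ?_
    have h1 := (ha ⟨0, Nat.pos_of_ne_zero hd⟩ trivial).1
    have h2 := (hb ⟨0, Nat.pos_of_ne_zero hd⟩ trivial).2
    have : (1 : ℝ) / 2 ^ b ≤ 1 / 2 ^ (a + 1) :=
      one_div_le_one_div_of_le (by positivity) (pow_le_pow_right₀ (by norm_num) hab)
    linarith
  intro a b hab
  rcases lt_or_gt_of_ne hab with h | h
  · exact key a b h
  · exact (key b a h).symm

lemma torusMeasure_dyadicCube (d k : ℕ) :
    torusMeasure d (dyadicCube d k) = ENNReal.ofReal (1 / (2 ^ (k + 1)) ^ d) := by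
  have hsub : Set.Ioc ((1 : ℝ) / 2 ^ (k + 1)) (1 / 2 ^ k) ⊆ Set.Ioc (-Real.pi) Real.pi := by
    have h1 : (1 : ℝ) / 2 ^ k ≤ 1 :=
      (div_le_one (by positivity)).2 (one_le_pow₀ (by norm_num))
    have h2 : (0 : ℝ) ≤ 1 / 2 ^ (k + 1) := by positivity
    have h3 := Real.pi_gt_three
    exact Set.Ioc_subset_Ioc (by linarith) (by linarith)
  rw [torusMeasure, dyadicCube, Measure.pi_pi]
  simp only [Measure.restrict_apply measurableSet_Ioc, Set.inter_eq_left.2 hsub, Real.volume_Ioc]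
  rw [Finset.prod_const, Finset.card_univ, Fintype.card_fin, ← ENNReal.ofReal_pow]
  · have h : (1 : ℝ) / 2 ^ k - 1 / 2 ^ (k + 1) = 1 / 2 ^ (k + 1) := by
      rw [pow_succ]
      field_simp
      norm_num
    rw [h, one_div_pow]
  · rw [sub_nonneg]
    exact one_div_le_one_div_of_le (by positivity) (pow_le_pow_right₀ (by norm_num) k.le_succ)

lemma tsum_ofReal_div_succ_eq_top {c : ℝ} (hc : 0 < c) :
    ∑' k : ℕ, ENNReal.ofReal (c / (k + 1)) = ⊤ := by
  by_contra h
  have h1 := ENNReal.summable_toReal h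
  simp only [fun k : ℕ => ENNReal.toReal_ofReal (show (0 : ℝ) ≤ c / (k + 1) by positivity)] at h1
  have h2 : Summable fun k : ℕ => 1 / ((k + 1 : ℕ) : ℝ) := by
    refine (h1.mul_left c⁻¹).congr fun k => ?_
    push_cast
    field_simp
  exact Real.not_summable_one_div_natCast ((summable_nat_add_iff 1).1 h2)

/-- The Chung–Fuchs integral diverges: the cube at scale `k` has volume of order `2 ^ (-k d)`, and
the integrand there is at least of order `2 ^ (k d) / (k + 1)`. -/
lemma lintegral_inv_one_sub_sq_eq_top {Ω : Type*} [MeasurableSpace Ω] {P : Measure Ω}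
    [IsProbabilityMeasure P] {d : ℕ} (hd : d = 1 ∨ d = 2) {Y : Ω → Fin d → ℤ} (hY : Measurable Y)
    {C : ℝ}
    (htail : ∀ x : Fin d → ℤ, x ≠ 0 → P.real {ω | Y ω = x} ≤ C / latticeNorm x ^ (2 * d)) :
    ∫⁻ θ, (1 - ENNReal.ofReal (cosTransform P Y θ ^ 2))⁻¹ ∂torusMeasure d = ⊤ := by
  have hd0 : d ≠ 0 := by omega
  obtain ⟨K, hK, hψ⟩ : ∃ K : ℝ, 0 < K ∧ ∀ k : ℕ, ∀ θ ∈ dyadicCube d k,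
      1 - cosTransform P Y θ ^ 2 ≤ K * ((k + 1) / (2 ^ k) ^ d) := by
    refine ⟨2 * (2 * (d : ℝ) ^ 2 * (2 * (8 ^ d * |C|)) + 1), by positivity, fun k θ hθ => ?_⟩
    have h1 := one_sub_cosTransform_le hd hY htail (θ := θ) (k := k) fun i => by
      have h := hθ i trivial
      rw [abs_of_pos (lt_trans (by positivity) h.1)]
      exact h.2
    have h2 := abs_le.1 (abs_cosTransform_le_one P Y θ)
    have h3 : (0 : ℝ) ≤ (k + 1) / (2 ^ k) ^ d := by positivity
    nlinarith [h2.1, h2.2]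
  rw [eq_top_iff, ← tsum_ofReal_div_succ_eq_top (c := 1 / (2 ^ d * K)) (by positivity)]
  refine le_trans (ENNReal.tsum_le_tsum fun k => ?_) (lintegral_iUnion
    (measurableSet_dyadicCube d) (pairwise_disjoint_dyadicCube hd0) _ ▸ setLIntegral_le_lintegral
      (⋃ k, dyadicCube d k) _)
  calc ENNReal.ofReal (1 / (2 ^ d * K) / (k + 1))
      = (ENNReal.ofReal (K * ((k + 1) / (2 ^ k) ^ d)))⁻¹ * torusMeasure d (dyadicCube d k) := by
        rw [torusMeasure_dyadicCube, ← ENNReal.ofReal_inv_of_pos (by positivity),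
          ← ENNReal.ofReal_mul (by positivity)]
        congr 1
        rw [pow_succ, mul_pow]
        field_simp
    _ = ∫⁻ _ in dyadicCube d k, (ENNReal.ofReal (K * ((k + 1) / (2 ^ k) ^ d)))⁻¹
          ∂torusMeasure d := (setLIntegral_const _ _).symm
    _ ≤ _ := by
        refine setLIntegral_mono' (measurableSet_dyadicCube d k) fun θ hθ => ?_
        rw [ENNReal.inv_le_inv, ← ENNReal.ofReal_one, ← ENNReal.ofReal_sub _ (sq_nonneg _)]
        exact ENNReal.ofReal_le_ofReal (hψ k θ hθ)

/-! ### Recurrence -/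

theorem theorem2 {Ω : Type*} [MeasurableSpace Ω] (P : Measure Ω) [IsProbabilityMeasure P]
    (d : ℕ) (hd : d = 1 ∨ d = 2)
    (X : ℕ → Ω → (Fin d → ℤ))
    (hmeas : ∀ k, Measurable (X k))
    (hindep : iIndepFun X P)
    (hident : ∀ k, IdentDistrib (X k) (X 0) P P)
    (hsymm : ∀ x : Fin d → ℤ, P.real {ω | X 0 ω = x} = P.real {ω | X 0 ω = -x})
    (C : ℝ)
    (htail : ∀ x : Fin d → ℤ, x ≠ 0 → P.real {ω | X 0 ω = x} ≤ C / latticeNorm x ^ (2 * d)) :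
    IsRecurrent (randomWalk X) P := by
  refine isRecurrent_of_tsum_eq_top hmeas hindep hident (eq_top_iff.2 ?_)
  have heven := tsum_even_visits hmeas hindep hident hsymm
  rw [lintegral_inv_one_sub_sq_eq_top hd (hmeas 0) htail] at heven
  have htop : ∑' n, P {ω | randomWalk X (2 * n) ω = 0} = ⊤ := by
    by_contra h
    exact ENNReal.mul_ne_top ENNReal.ofReal_ne_top h heven.symm
  rw [← htop]
  exact ENNReal.tsum_comp_le_tsum_of_injective (mul_right_injective₀ two_ne_zero)
    fun n => P {ω | randomWalk X n ω = 0}
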